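/- **Model.** Base stations (BSs) form a homogeneous Poisson point process (PPP) in $\mathbb R^2$ of intensity $\lambda_B>0$, devices one of intensity $\lambda_D>0$; there are $\xi\ge 1$ preambles and $\lambda_{Dp}=\lambda_D/\xi$. Let $\alpha>2$ be the path-loss exponent, $\rho>0$ the power-control threshold, $\sigma^2\ge 0$ the noise power, $\gamma>0$ the SINR threshold, and $c=3.575$. In slot $m$ a device is *active* if its buffer is non-empty ($N^m_{\rm New}+N^m_{\rm Cum}>0$, probability $\mathcal T^m$) and the access scheme leaves it unrestricted (probability $\mathcal R^m$, independently). The BS serving a randomly chosen device is placed at the origin, and a preamble is fixed. *Inter-cell interference.* The devices of the PPP carry independent marks, independent of the locations: a uniformly distributed preamble, the distance $r_i$ to the serving BS, distributed as the distance from a fixed location to the nearest point of the BS process, a channel gain $h_i\sim\mathrm{Exp}(1)$ to the origin, and buffer and access states as above. A device at location $u_i$ transmits with power $P_i=\rho r_i^\alpha$, and $$\mathcal I_{\rm inter}=\sum_i P_i h_i\|u_i\|^{-\alpha},$$ summed over the active devices that use the fixed preamble and satisfy $\|u_i\|>r_i$. *Intra-cell interference.* $\mathcal I_{\rm intra}=\sum_j\rho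 h_j$, summed over the other active devices of the cell of the chosen device that use the same preamble, with i.i.d. $h_j\sim\mathrm{Exp}(1)$; their number $Z_D$ has the device-biased cell-load distribution $$\mathbb P\{Z_D=n\}=\frac{c^{c+1}\,\Gamma(n+c+1)\,x^n}{\Gamma(c+1)\,\Gamma(n+1)\,(x+c)^{n+c+1}}\quad(n\ge 0),\qquad x=\frac{\mathcal T^m\mathcal R^m\lambda_{Dp}}{\lambda_B}.$$ The gain $h_0\sim\mathrm{Exp}(1)$ of the chosen device, the gains $(h_j)$, the configuration of the cell (which devices it holds, and their states) and the marked PPP of devices are mutually independent. **Theorem 1.** The preamble transmission success probability in slot $m$ of a randomly chosen device, $$\mathcal P^m=\mathbb P\Big\{\frac{\rho h_0}{\mathcal I_{\rm intra}+\mathcal I_{\rm inter}+\sigma^2}\ge\gamma\Big\},$$ is given by $$\mathcal P^m=\exp\Big(-\frac{\gamma\sigma^2}{\rho}-2\gamma^{2/\alpha}\,\frac{\mathcal T^m\mathcal R^m\lambda_{Dp}}{\lambda_B}\int_{\gamma^{-1/\alpha}}^\infty\frac{y}{1+y^\alpha}\,dy\Big)\Big(1+\frac{\mathcal T^m\mathcal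 R^m\lambda_{Dp}\,\gamma}{c\,\lambda_B(1+\gamma)}\Big)^{-c-1},$$ where the integral converges. -/

import Mathlib

open MeasureTheory ProbabilityTheory Set
open scoped ENNReal

noncomputable section

/-- The Euclidean plane, in which base stations and devices are deployed. -/
abbrev Plane : Type := EuclideanSpace ℝ (Fin 2)

/-- `Φ` is a (simple) Poisson point process with intensity measure `Λ`: a random set of points whose
numbers of points in measurable sets are random variables, Poisson distributed with mean `Λ B` when
`Λ B < ∞`, and independent for pairwise disjoint sets. -/
structure IsPoissonProcess {Ω E : Type*} [MeasurableSpace Ω] [MeasurableSpace E]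
    (Φ : Ω → Set E) (Λ : Measure E) (P : Measure Ω) : Prop where
  measurable_count : ∀ B : Set E, MeasurableSet B → Measurable fun ω => (Φ ω ∩ B).encard
  law_count : ∀ B : Set E, MeasurableSet B → Λ B < ∞ →
    HasLaw (fun ω => (Φ ω ∩ B).encard)
      ((poissonMeasure (Λ B).toNNReal).map (fun k : ℕ => (k : ℕ∞))) P
  indep_count : ∀ (k : ℕ) (B : Fin k → Set E), (∀ i, MeasurableSet (B i)) →
    (∀ i j, i ≠ j → Disjoint (B i) (B j)) →
    iIndepFun (fun (i : Fin k) (ω : Ω) => (Φ ω ∩ B i).encard) P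

/-- The σ-algebra generated by a random set of points, i.e. by all its counts in measurable sets. -/
@[reducible] def countSigma {Ω E : Type*} [MeasurableSpace E] (Φ : Ω → Set E) : MeasurableSpace Ω :=
  ⨆ B : {B : Set E // MeasurableSet B},
    MeasurableSpace.comap (fun ω => (Φ ω ∩ B.1).encard) inferInstance

/-- State of a device in a slot: the numbers `(N_New, N_Cum)` of newly arrived and of accumulated
packets in its buffer, and whether the access scheme leaves it unrestricted (`true`). -/
abbrev DeviceState : Type := (ℕ × ℕ) × Bool

/-- A device is active if its buffer is non-empty and it is unrestricted. -/
def DeviceState.IsActive (s : DeviceState) : Prop := 0 < s.1.1 + s.1.2 ∧ s.2 = true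

instance (s : DeviceState) : Decidable s.IsActive := by
  unfold DeviceState.IsActive; infer_instance

/-- The parameters of the network. -/
structure RachNetwork where
  /-- intensity of the base stations -/
  lamB : ℝ
  /-- intensity of the devices -/
  lamD : ℝ
  /-- number of preambles -/
  xi : ℕ
  /-- path-loss exponent -/
  alpha : ℝ
  /-- power-control threshold -/
  rho : ℝ
  /-- the noise power is `sigma ^ 2` -/
  sigma : ℝ
  /-- SINR threshold -/
  gammaTh : ℝ
  /-- law of `(N_New, N_Cum)` of a device in each slot -/
  queueLaw : ℕ → Measure (ℕ × ℕ)
  /-- law of "unrestricted" of a device in each slot, as determined by the access scheme -/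
  accessLaw : ℕ → Measure Bool
  lamB_pos : 0 < lamB
  lamD_pos : 0 < lamD
  xi_pos : 0 < xi
  two_lt_alpha : 2 < alpha
  rho_pos : 0 < rho
  gammaTh_pos : 0 < gammaTh
  prob_queue : ∀ m, IsProbabilityMeasure (queueLaw m)
  prob_access : ∀ m, IsProbabilityMeasure (accessLaw m)

/-- The Voronoi-cell constant. -/
def voronoiConst : ℝ := 3.575

/-- The device-biased cell-load PMF: probability that the cell containing a randomly chosen device
holds `n` further devices, when `x` is the ratio of device intensity to base-station intensity. -/
def deviceBiasedLoad (x : ℝ) (n : ℕ) : ℝ :=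
  voronoiConst ^ (voronoiConst + 1) * Real.Gamma (n + voronoiConst + 1) * x ^ n /
    (Real.Gamma (voronoiConst + 1) * Real.Gamma (n + 1) *
      (x + voronoiConst) ^ ((n : ℝ) + voronoiConst + 1))

namespace RachNetwork

variable (net : RachNetwork)

/-- Intensity of the devices that use one given preamble. -/
def lamDp : ℝ := net.lamD / net.xi

/-- Non-empty probability in slot `m`. -/
def T (m : ℕ) : ℝ := (net.queueLaw m).real {q | 0 < q.1 + q.2}

/-- Non-restrict probability in slot `m`. -/
def R (m : ℕ) : ℝ := (net.accessLaw m).real {true}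

/-- Law of the state of a device in slot `m`. -/
def stateLaw (m : ℕ) : Measure DeviceState := (net.queueLaw m).prod (net.accessLaw m)

/-- A deployed device: its location `u`, its preamble, the distance `r` to its serving base station,
its channel power gain `h` to the typical base station, and its state. -/
abbrev Device : Type := Plane × Fin net.xi × ℝ × ℝ × DeviceState

variable {net}

/-- Location. -/
def Device.loc (d : net.Device) : Plane := d.1
/-- Preamble. -/
def Device.preamble (d : net.Device) : Fin net.xi := d.2.1
/-- Distance to the serving base station. -/
def Device.dist (d : net.Device) : ℝ := d.2.2.1
/-- Channel power gain to the typical base station. -/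
def Device.gain (d : net.Device) : ℝ := d.2.2.2.1
/-- State. -/
def Device.state (d : net.Device) : DeviceState := d.2.2.2.2
/-- Transmit power `P = ρ r ^ α` (full path-loss inversion). -/
def Device.power (d : net.Device) : ℝ := net.rho * d.dist ^ net.alpha

variable (net)

/-- The intensity measure of the deployed devices: homogeneous of intensity `λ_D` in the plane, with
mutually independent marks: a uniform preamble, a serving distance of law `distLaw`, a unit-mean
exponential channel gain, and the state in slot `m`. -/
def deviceIntensity (distLaw : Measure ℝ) (m : ℕ) : Measure net.Device :=
  (ENNReal.ofReal net.lamD • (volume : Measure Plane)).prod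
    ((uniformOn (univ : Set (Fin net.xi))).prod
      (distLaw.prod ((expMeasure 1).prod (net.stateLaw m))))

/-- The random quantities in slot `m` seen from the base station, placed at the origin, that serves
a randomly chosen device using the preamble `p₀`. -/
structure Slot (m : ℕ) (p₀ : Fin net.xi) (Ω : Type*) [MeasurableSpace Ω] (P : Measure Ω) where
  /-- the base stations, which determine the law of the distance from a location to the nearest one -/
  bs : Ω → Set Plane
  /-- the deployed devices with their marks -/
  devices : Ω → Set net.Device
  /-- channel gain of the chosen device -/
  h₀ : Ω → ℝ
  /-- channel gains of the other devices of the cell that use the preamble `p₀` -/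
  h : Ω → ℕ → ℝ
  /-- number of other devices of the cell that use the preamble `p₀`, and their states -/
  cell : Ω → ℕ × (ℕ → DeviceState)
  measurable_h₀ : Measurable h₀
  measurable_h : Measurable h
  measurable_cell : Measurable cell
  bs_poisson : IsPoissonProcess bs (ENNReal.ofReal net.lamB • (volume : Measure Plane)) P
  devices_poisson : IsPoissonProcess devices
    (net.deviceIntensity (P.map fun ω => Metric.infDist (0 : Plane) (bs ω)) m) P
  h₀_law : HasLaw h₀ (expMeasure 1) P
  h_law : ∀ j, HasLaw (fun ω => h ω j) (expMeasure 1) P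
  h_indep : iIndepFun (fun (j : ℕ) (ω : Ω) => h ω j) P
  state_law : ∀ j, HasLaw (fun ω => (cell ω).2 j) (net.stateLaw m) P
  /-- the number `Z_D` of active interferers in the cell has the device-biased cell-load PMF -/
  load_law : ∀ n : ℕ,
    P.real {ω | ((Finset.range (cell ω).1).filter fun j => ((cell ω).2 j).IsActive).card = n} =
      deviceBiasedLoad (net.T m * net.R m * net.lamDp / net.lamB) n
  /-- chosen device's gain, intra-cell gains, cell configuration and deployed devices are mutually
  independent -/
  indep : iIndep ![MeasurableSpace.comap h₀ inferInstance, MeasurableSpace.comap h inferInstance,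
    MeasurableSpace.comap cell inferInstance, countSigma devices] P

namespace Slot

variable {net} {m : ℕ} {p₀ : Fin net.xi} {Ω : Type*} [MeasurableSpace Ω] {P : Measure Ω}
  (S : net.Slot m p₀ Ω P)

/-- Aggregate intra-cell interference: every active device of the cell is received with power
`ρ h_j`. -/
def intra (ω : Ω) : ℝ≥0∞ :=
  ∑ j ∈ Finset.range (S.cell ω).1,
    if ((S.cell ω).2 j).IsActive then ENNReal.ofReal (net.rho * S.h ω j) else 0

/-- The inter-cell devices using the preamble `p₀`: their serving base station is closer to them
than the typical base station at the origin. -/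
def out (ω : Ω) : Set net.Device :=
  {d | d ∈ S.devices ω ∧ d.preamble = p₀ ∧ d.dist < ‖d.loc‖}

/-- Aggregate inter-cell interference: every active inter-cell device is received with power
`P h ‖u‖ ^ (-α)`. -/
def inter (ω : Ω) : ℝ≥0∞ :=
  ∑' d : S.out ω,
    if d.1.state.IsActive then
      ENNReal.ofReal (d.1.power * d.1.gain * ‖d.1.loc‖ ^ (-net.alpha)) else 0

/-- The SINR of the chosen device at its base station, with values in `[0, ∞]` (it is `∞` when there
is neither noise nor interference and `h₀ > 0`). -/
def sinr (ω : Ω) : ℝ≥0∞ :=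
  ENNReal.ofReal (net.rho * S.h₀ ω) / (S.intra ω + S.inter ω + ENNReal.ofReal (net.sigma ^ 2))

/-- Preamble transmission success probability: the probability that the SINR reaches the
threshold. -/
def successProb : ℝ := P.real {ω | ENNReal.ofReal net.gammaTh ≤ S.sinr ω}

end Slot

end RachNetwork

end

-- With `γ`, `ρ`, `α`, `c` as in the statement, success means `h₀ ≥ (γ/ρ)(intra + inter + σ²)`
-- (`le_sinr_iff`). The exponential tail of `h₀`, independent of the right-hand side, turns the
-- probability of this event into the mean of `exp (-(γ/ρ)(intra + inter + σ²))`, which factors into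
-- two Laplace transforms and the noise term (`successProb_eq_mul`).
--
-- Intra-cell factor: averaging over the gains leaves `(1/(1+γ)) ^ Z_D`. The load law is negative
-- binomial, so its generating function is a binomial series with exponent `-(c+1)`
-- (`hasSum_deviceBiasedLoad`).
--
-- Inter-cell factor: the Laplace functional `IsPoissonProcess.lintegral_expNeg_tsum` gives `exp (-∫
-- (1 - exp (-f)) dΛ)`. Integrating out the marks (`lintegral_contribution`), preamble and state
-- thin the intensity, the gain produces a rational function of `γ r^α ‖u‖^(-α)`, and integration
-- over the location scales as `r²` (`lintegral_outside_ball`). Only the second moment `1/(π λ_B)`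
-- of the contact distance is then needed; void probabilities supply it
-- (`IsPoissonProcess.lintegral_infDist_sq`).
--
-- Interference takes values in `[0, ∞]` and `expNeg ∞ = 0`, so its finiteness never has to be
-- proved.

noncomputable section

/-! ### The function `exp (-x)` on `[0, ∞]` -/

/-- `exp (-x)` for `x ∈ [0, ∞]`, with value `0` at `∞`. -/
def expNeg (x : ℝ≥0∞) : ℝ≥0∞ := (EReal.exp (x : EReal))⁻¹

lemma expNeg_zero : expNeg 0 = 1 := by simp [expNeg]

lemma expNeg_top : expNeg ∞ = 0 := by simp [expNeg]

lemma expNeg_ofReal {x : ℝ} (hx : 0 ≤ x) : expNeg (ENNReal.ofReal x) = ENNReal.ofReal (Real.exp (-x)) := by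
  rw [expNeg, EReal.coe_ennreal_ofReal, max_eq_left hx, EReal.exp_coe, Real.exp_neg,
    ENNReal.ofReal_inv_of_pos (Real.exp_pos _)]

lemma expNeg_add (x y : ℝ≥0∞) : expNeg (x + y) = expNeg x * expNeg y := by
  rw [expNeg, EReal.coe_ennreal_add, EReal.exp_add, ENNReal.mul_inv]
  · rfl
  · left; simp
  · right; simp

lemma expNeg_sum {ι : Type*} (s : Finset ι) (f : ι → ℝ≥0∞) :
    expNeg (∑ i ∈ s, f i) = ∏ i ∈ s, expNeg (f i) := by
  classical
  induction s using Finset.induction_on with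
  | empty => simp [expNeg_zero]
  | insert a s ha ih => rw [Finset.sum_insert ha, Finset.prod_insert ha, expNeg_add, ih]

lemma continuous_expNeg : Continuous expNeg :=
  continuous_inv.comp (ENNReal.continuous_exp.comp continuous_coe_ennreal_ereal)

lemma measurable_expNeg : Measurable expNeg := continuous_expNeg.measurable

lemma antitone_expNeg : Antitone expNeg := fun x y h => by
  unfold expNeg
  rw [ENNReal.inv_le_inv, EReal.exp_le_exp_iff]
  exact_mod_cast h

lemma expNeg_le_one (x : ℝ≥0∞) : expNeg x ≤ 1 := by
  rw [← expNeg_zero]; exact antitone_expNeg zero_le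

lemma expNeg_natCast_mul (n : ℕ) (c : ℝ≥0∞) : expNeg (n * c) = expNeg c ^ n := by
  have h := expNeg_sum (Finset.range n) fun _ => c
  simpa using h

/-- This is the Poisson generating function at `q = expNeg c`; `c = ∞` is covered, with `q = 0`. -/
lemma lintegral_expNeg_poisson (r : NNReal) (c : ℝ≥0∞) :
    ∫⁻ n : ℕ, expNeg (c * n) ∂(poissonMeasure r) = expNeg ((1 - expNeg c) * r) := by
  obtain ⟨q, hq⟩ : ∃ q : NNReal, expNeg c = q :=
    ⟨(expNeg c).toNNReal, (ENNReal.coe_toNNReal (ne_top_of_le_ne_top (by simp) (expNeg_le_one c))).symm⟩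
  have hq1 : (q : ℝ) ≤ 1 := by
    have := expNeg_le_one c
    rw [hq] at this
    exact_mod_cast this
  rw [lintegral_countable']
  have h1 : ∀ n : ℕ, expNeg (c * n) * poissonMeasure r {n} =
      ENNReal.ofReal (Real.exp (-r) * ((q * r : ℝ) ^ n / n.factorial)) := by
    intro n
    rw [mul_comm c, expNeg_natCast_mul, poissonMeasure_singleton, hq, ← ENNReal.ofReal_coe_nnreal,
      ← ENNReal.ofReal_pow q.coe_nonneg, ← ENNReal.ofReal_mul (by positivity)]
    congr 1
    rw [mul_pow]; ring
  simp_rw [h1]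
  have h2 := (NormedSpace.expSeries_div_hasSum_exp (q * r : ℝ)).mul_left (Real.exp (-r))
  rw [← Real.exp_eq_exp_ℝ] at h2
  rw [← ENNReal.ofReal_tsum_of_nonneg (fun n => by positivity) h2.summable, h2.tsum_eq, hq,
    ← ENNReal.ofReal_coe_nnreal, ← ENNReal.ofReal_one, ← ENNReal.ofReal_sub _ q.coe_nonneg,
    ← ENNReal.ofReal_coe_nnreal (p := r), ← ENNReal.ofReal_mul (by linarith), expNeg_ofReal
    (mul_nonneg (by linarith) r.coe_nonneg), ← Real.exp_add]
  congr 2; ring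

/-! ### Sums over a random set of points -/

section PointSums

variable {Ω E : Type*} [MeasurableSpace Ω] [MeasurableSpace E] {Φ : Ω → Set E} {Λ : Measure E}
  {P : Measure Ω}

/-- Grouping points by level sets reduces sums to counts. Level `0` is dropped because it adds
nothing and its level set may have infinite intensity. -/
lemma tsum_simpleFunc (A : Set E) (f : SimpleFunc E ℝ≥0∞) :
    ∑' d : A, f d = ∑ c ∈ f.range with c ≠ 0, c * ((A ∩ f ⁻¹' {c}).encard : ℝ≥0∞) := by
  have h1 : ∀ d : E, f d = ∑ c ∈ f.range with c ≠ 0, (f ⁻¹' {c}).indicator (fun _ => c) d := by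
    intro d
    by_cases hd : f d = 0
    · rw [hd, eq_comm]
      refine Finset.sum_eq_zero fun c hc => ?_
      refine indicator_of_notMem (fun h => ?_) _
      simp only [mem_preimage, mem_singleton_iff] at h
      simp [← h, hd] at hc
    · rw [Finset.sum_eq_single (f d)]
      · simp
      · intro c _ hc
        exact indicator_of_notMem (fun h => hc (by simpa using h.symm)) _
      · simp [hd]
  calc ∑' d : A, f d = ∑' d : A, ∑ c ∈ f.range with c ≠ 0, (f ⁻¹' {c}).indicator (fun _ => c) (d : E) :=
        tsum_congr fun d => h1 d
    _ = ∑ c ∈ f.range with c ≠ 0, ∑' d : A, (f ⁻¹' {c}).indicator (fun _ => c) (d : E) :=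
        Summable.tsum_finsetSum fun _ _ => ENNReal.summable
    _ = _ := by
        refine Finset.sum_congr rfl fun c _ => ?_
        rw [tsum_subtype A ((f ⁻¹' {c}).indicator fun _ => c), indicator_indicator,
          ← tsum_subtype (A ∩ f ⁻¹' {c}) (fun _ => c), ENNReal.tsum_set_const, mul_comm]

lemma tsum_iSup_of_monotone {ι : Type*} {f : ℕ → ι → ℝ≥0∞} (hf : Monotone f) :
    ∑' i, ⨆ n, f n i = ⨆ n, ∑' i, f n i := by
  simp_rw [ENNReal.tsum_eq_iSup_sum]
  rw [iSup_comm]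
  refine iSup_congr fun s => ?_
  exact ENNReal.finsetSum_iSup_of_monotone fun i m n h => hf h i

lemma measurable_encard_countSigma {Ω E : Type*} [MeasurableSpace E] (Φ : Ω → Set E) {B : Set E} (hB : MeasurableSet B) :
    Measurable[countSigma Φ] fun ω => (Φ ω ∩ B).encard :=
  (comap_measurable (fun ω => (Φ ω ∩ B).encard)).mono
    (le_iSup (fun B : {B : Set E // MeasurableSet B} =>
      MeasurableSpace.comap (fun ω => (Φ ω ∩ B.1).encard) inferInstance) ⟨B, hB⟩) le_rfl

/-- Only counts are known to be measurable. A sum over the points is a monotone limit of finite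
combinations of counts, so it inherits every independence property of `countSigma Φ`. -/
lemma measurable_tsum_countSigma {Ω E : Type*} [MeasurableSpace E] (Φ : Ω → Set E) {f : E → ℝ≥0∞} (hf : Measurable f) :
    Measurable[countSigma Φ] fun ω => ∑' d : Φ ω, f d := by
  have h1 : ∀ ω, ∑' d : Φ ω, f d = ⨆ n, ∑' d : Φ ω, SimpleFunc.eapprox f n d := by
    intro ω
    rw [← tsum_iSup_of_monotone]
    · simp_rw [SimpleFunc.iSup_eapprox_apply hf]
    · intro m n h d
      exact SimpleFunc.monotone_eapprox f h d
  simp_rw [h1]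
  refine Measurable.iSup fun n => ?_
  simp_rw [tsum_simpleFunc]
  refine Finset.measurable_sum _ fun c _ => ?_
  refine Measurable.const_mul ?_ _
  exact (Measurable.of_discrete (f := ENat.toENNReal)).comp
    (measurable_encard_countSigma Φ (SimpleFunc.measurableSet_fiber _ _))

lemma IsPoissonProcess.countSigma_le (h : IsPoissonProcess Φ Λ P) :
    countSigma Φ ≤ (inferInstance : MeasurableSpace Ω) :=
  iSup_le fun B => (h.measurable_count B.1 B.2).comap_le

lemma IsPoissonProcess.lintegral_expNeg_count (h : IsPoissonProcess Φ Λ P) {B : Set E}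
    (hB : MeasurableSet B) (hΛ : Λ B < ∞) (c : ℝ≥0∞) :
    ∫⁻ ω, expNeg (c * (Φ ω ∩ B).encard) ∂P = expNeg ((1 - expNeg c) * Λ B) := by
  have h1 := (h.law_count B hB hΛ).lintegral_comp (f := fun n : ℕ∞ => expNeg (c * n))
    Measurable.of_discrete.aemeasurable
  rw [h1, lintegral_map Measurable.of_discrete Measurable.of_discrete]
  simp only [ENat.toENNReal_coe]
  rw [lintegral_expNeg_poisson, ENNReal.coe_toNNReal hΛ.ne]

/-- Distinct level sets are disjoint, hence have independent Poisson counts, and the expectation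
splits into one-level factors. -/
lemma IsPoissonProcess.lintegral_expNeg_simpleFunc (h : IsPoissonProcess Φ Λ P)
    (f : SimpleFunc E ℝ≥0∞) (hf : ∀ c ≠ 0, Λ (f ⁻¹' {c}) < ∞) :
    ∫⁻ ω, expNeg (∑' d : Φ ω, f d) ∂P = expNeg (∫⁻ d, (1 - expNeg (f d)) ∂Λ) := by
  set s := f.range.filter (· ≠ 0) with hs
  let e := s.equivFin
  have hind := h.indep_count s.card (fun i => f ⁻¹' {(e.symm i : ℝ≥0∞)})
    (fun i => f.measurableSet_fiber _) (fun i j hij => by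
      refine Disjoint.preimage _ ?_
      simp only [disjoint_singleton, ne_eq]
      exact fun hh => hij (e.symm.injective (Subtype.ext hh)))
  have hind2 : iIndepFun (fun (i : Fin s.card) (ω : Ω) => expNeg ((e.symm i : ℝ≥0∞) *
      (Φ ω ∩ f ⁻¹' {(e.symm i : ℝ≥0∞)}).encard)) P :=
    hind.comp (fun i (n : ℕ∞) => expNeg ((e.symm i : ℝ≥0∞) * n)) fun i => Measurable.of_discrete
  have hL : ∀ ω, expNeg (∑' d : Φ ω, f d) = ∏ i : Fin s.card, expNeg ((e.symm i : ℝ≥0∞) *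
      (Φ ω ∩ f ⁻¹' {(e.symm i : ℝ≥0∞)}).encard) := by
    intro ω
    rw [tsum_simpleFunc, expNeg_sum, ← hs, ← Finset.prod_coe_sort, ← Equiv.prod_comp e.symm]
  have hR : ∫⁻ d, (1 - expNeg (f d)) ∂Λ = ∑ c ∈ s, (1 - expNeg c) * Λ (f ⁻¹' {c}) := by
    have h1 : ∫⁻ d, (1 - expNeg (f d)) ∂Λ = ∫⁻ d, f.map (fun c => 1 - expNeg c) d ∂Λ := rfl
    rw [h1, SimpleFunc.lintegral_eq_lintegral, SimpleFunc.map_lintegral, hs, Finset.sum_filter]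
    refine Finset.sum_congr rfl fun c _ => ?_
    split_ifs with hc
    · rfl
    · rw [not_not.1 hc, expNeg_zero, tsub_self, zero_mul]
  simp_rw [hL]
  rw [lintegral_prod_eq_prod_lintegral_of_indepFun _ _ hind2, hR, expNeg_sum,
    ← Finset.prod_coe_sort s, ← Equiv.prod_comp e.symm]
  · refine Finset.prod_congr rfl fun i _ => ?_
    exact h.lintegral_expNeg_count (f.measurableSet_fiber _)
      (hf _ (Finset.mem_filter.1 (e.symm i).2).2) _
  · intro i
    exact Measurable.comp (g := fun n : ℕ∞ => expNeg ((e.symm i : ℝ≥0∞) * n)) Measurable.of_discrete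
      (h.measurable_count _ (f.measurableSet_fiber _))

/-- The Laplace functional of a Poisson process. -/
theorem IsPoissonProcess.lintegral_expNeg_tsum [IsProbabilityMeasure P] [SigmaFinite Λ]
    (h : IsPoissonProcess Φ Λ P) {f : E → ℝ≥0∞} (hf : Measurable f) :
    ∫⁻ ω, expNeg (∑' d : Φ ω, f d) ∂P = expNeg (∫⁻ d, (1 - expNeg (f d)) ∂Λ) := by
  -- Cutting off to sets of finite intensity makes every nonzero level set of `g n` finite in
  -- measure and keeps the approximation increasing.
  let g : ℕ → SimpleFunc E ℝ≥0∞ := fun n =>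
    (SimpleFunc.eapprox f n).restrict (spanningSets Λ n)
  have gval : ∀ n d, g n d = (spanningSets Λ n).indicator (SimpleFunc.eapprox f n) d := fun n d => by
    rw [SimpleFunc.restrict_apply _ (measurableSet_spanningSets Λ n)]
  have hmono : Monotone fun n d => g n d := by
    intro m n hmn d
    simp only [gval]
    refine (indicator_le_indicator_of_subset (monotone_spanningSets Λ hmn) (fun _ => zero_le) d).trans ?_
    exact indicator_le_indicator (SimpleFunc.monotone_eapprox f hmn d)
  have hsup : ∀ d, ⨆ n, g n d = f d := by
    intro d
    apply le_antisymm
    · refine iSup_le fun n => ?_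
      rw [gval, ← SimpleFunc.iSup_eapprox_apply hf d]
      exact (indicator_le_self _ _ d).trans (le_iSup (fun n => SimpleFunc.eapprox f n d) n)
    · rw [← SimpleFunc.iSup_eapprox_apply hf d]
      refine iSup_le fun n => ?_
      obtain ⟨k, hk⟩ : ∃ k, d ∈ spanningSets Λ k := ⟨_, mem_spanningSetsIndex Λ d⟩
      refine le_iSup_of_le (max n k) ?_
      rw [gval, indicator_of_mem (monotone_spanningSets Λ (le_max_right n k) hk)]
      exact SimpleFunc.monotone_eapprox f (le_max_left n k) d
  have hfin : ∀ n, ∀ c ≠ 0, Λ (g n ⁻¹' {c}) < ∞ := by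
    intro n c hc
    refine (measure_mono ?_).trans_lt (measure_spanningSets_lt_top Λ n)
    intro d hd
    by_contra hd2
    apply hc
    rw [mem_preimage, mem_singleton_iff, gval, indicator_of_notMem hd2] at hd
    exact hd.symm
  have hpt : ∀ ω, Filter.Tendsto (fun n => expNeg (∑' d : Φ ω, g n d)) Filter.atTop
      (nhds (expNeg (∑' d : Φ ω, f d))) := by
    intro ω
    refine (continuous_expNeg.tendsto _).comp ?_
    simp_rw [← hsup]
    rw [tsum_iSup_of_monotone (f := fun n (d : Φ ω) => g n d) fun m n hmn d => hmono hmn d]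
    exact tendsto_atTop_iSup fun m n hmn => ENNReal.tsum_le_tsum fun d => hmono hmn d
  -- Here the integrands decrease and are bounded by `1` on a probability space; on the side of `Λ`,
  -- possibly infinite, `1 - expNeg` increases and monotone convergence applies.
  have hL : Filter.Tendsto (fun n => ∫⁻ ω, expNeg (∑' d : Φ ω, g n d) ∂P) Filter.atTop
      (nhds (∫⁻ ω, expNeg (∑' d : Φ ω, f d) ∂P)) := by
    refine tendsto_lintegral_of_dominated_convergence (fun _ => 1) (fun n => ?_)
      (fun n => Filter.Eventually.of_forall fun ω => expNeg_le_one _) (by simp)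
      (Filter.Eventually.of_forall hpt)
    exact measurable_expNeg.comp
      ((measurable_tsum_countSigma Φ (g n).measurable).mono h.countSigma_le le_rfl)
  have hR : Filter.Tendsto (fun n => ∫⁻ d, (1 - expNeg (g n d)) ∂Λ) Filter.atTop
      (nhds (∫⁻ d, (1 - expNeg (f d)) ∂Λ)) := by
    refine lintegral_tendsto_of_tendsto_of_monotone (fun n => ?_) ?_ ?_
    · exact ((measurable_expNeg.comp (g n).measurable).const_sub 1).aemeasurable
    · refine Filter.Eventually.of_forall fun d m n hmn => ?_
      exact tsub_le_tsub_left (antitone_expNeg (hmono hmn d)) _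
    · refine Filter.Eventually.of_forall fun d => ?_
      refine ENNReal.Tendsto.sub tendsto_const_nhds ((continuous_expNeg.tendsto _).comp ?_)
        (Or.inl (by simp))
      rw [← hsup]
      exact tendsto_atTop_iSup fun m n hmn => hmono hmn d
  refine tendsto_nhds_unique hL ?_
  simp_rw [fun n => h.lintegral_expNeg_simpleFunc (g n) (hfin n)]
  exact (continuous_expNeg.tendsto _).comp hR

end PointSums

/-! ### The exponential law -/

instance : IsProbabilityMeasure (expMeasure 1) := isProbabilityMeasure_expMeasure one_pos

lemma expMeasure_le_ofReal (w : ℝ≥0∞) : expMeasure 1 {t | w ≤ ENNReal.ofReal t} = expNeg w := by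
  by_cases hw : w = ∞
  · simp [hw, expNeg_top]
  obtain ⟨x, hx, rfl⟩ : ∃ x : ℝ, 0 ≤ x ∧ w = ENNReal.ofReal x :=
    ⟨w.toReal, ENNReal.toReal_nonneg, (ENNReal.ofReal_toReal hw).symm⟩
  -- At `x = 0` the event is the whole line, negative `t` included, since `ENNReal.ofReal`
  -- truncates; for `x > 0` it is `Ici x`.
  rcases hx.eq_or_lt with rfl | hx0
  · simp [expNeg_zero]
  have : NullSingletonClass (expMeasure 1) := by
    unfold expMeasure gammaMeasure
    infer_instance
  have h1 : {t | ENNReal.ofReal x ≤ ENNReal.ofReal t} = Ici x := by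
    ext t
    simp only [mem_ofPred_eq, mem_Ici]
    refine ⟨fun h => ?_, ENNReal.ofReal_le_ofReal⟩
    by_contra! h2
    exact absurd ((ENNReal.ofReal_lt_ofReal_iff hx0).2 h2) (not_lt.2 h)
  rw [h1, ← measure_congr Ioi_ae_eq_Ici, ← compl_Iic, prob_compl_eq_one_sub measurableSet_Iic,
    ← ofReal_cdf, cdf_expMeasure_eq one_pos, if_pos hx, expNeg_ofReal hx, ← ENNReal.ofReal_one,
    ← ENNReal.ofReal_sub]
  · simp
  · simp [hx]

/-- Tilting the `Exp(1)` density by `exp (-a t)` gives `1/(1+a)` times the `Exp(1+a)` density, which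
has mass one. -/
lemma lintegral_expNeg_expMeasure {a : ℝ} (ha : 0 ≤ a) :
    ∫⁻ t, expNeg (ENNReal.ofReal (a * t)) ∂(expMeasure 1) = ENNReal.ofReal (1 / (1 + a)) := by
  have hm : Measurable fun t : ℝ => expNeg (ENNReal.ofReal (a * t)) :=
    measurable_expNeg.comp (by fun_prop)
  have h0 : expMeasure 1 = volume.withDensity (exponentialPDF 1) := rfl
  have hd : ∀ r, Measurable (exponentialPDF r) :=
    fun r => (measurable_exponentialPDFReal r).ennreal_ofReal
  rw [h0, lintegral_withDensity_eq_lintegral_mul _ (hd 1) hm]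
  have h1 : ∀ t, (exponentialPDF 1 * fun t => expNeg (ENNReal.ofReal (a * t))) t =
      ENNReal.ofReal (1 / (1 + a)) * exponentialPDF (1 + a) t := by
    intro t
    rw [Pi.mul_apply]
    rcases lt_or_ge t 0 with ht | ht
    · simp [exponentialPDF_of_neg ht]
    · rw [exponentialPDF_of_nonneg ht, exponentialPDF_of_nonneg ht, expNeg_ofReal (by positivity),
        ← ENNReal.ofReal_mul (by positivity), ← ENNReal.ofReal_mul (by positivity), one_mul, one_mul,
        ← Real.exp_add, ← mul_assoc, one_div, inv_mul_cancel₀ (by positivity), one_mul]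
      congr 2; ring
  simp_rw [h1]
  rw [lintegral_const_mul _ (hd _),
    lintegral_exponentialPDF_eq_one (by linarith), mul_one]

/-! ### The device-biased cell load -/

/-- This matches the coefficients of `(1 - t) ^ (-a)` with the Gamma quotients of the load law. -/
lemma choose_eq_Gamma_div {a : ℝ} (ha : 0 < a) (n : ℕ) :
    Ring.choose (a + n - 1) n = Real.Gamma (n + a) / (Real.Gamma a * Real.Gamma (n + 1)) := by
  have h1 : ∀ n : ℕ, (ascPochhammer ℝ n).eval a * Real.Gamma a = Real.Gamma (n + a) := by
    intro n
    induction n with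
    | zero => simp
    | succ n ih =>
      rw [ascPochhammer_succ_eval, mul_right_comm, ih, Nat.cast_succ,
        show (n : ℝ) + 1 + a = (n + a) + 1 by ring, Real.Gamma_add_one (by positivity)]
      ring
  have h2 := Ring.factorial_nsmul_multichoose_eq_ascPochhammer a n
  rw [Ring.multichoose_eq, Polynomial.ascPochhammer_smeval_eq_eval, nsmul_eq_mul] at h2
  rw [← h1, ← h2, Real.Gamma_nat_eq_factorial]
  have := (Real.Gamma_pos_of_pos ha).ne'
  have : (n.factorial : ℝ) ≠ 0 := by positivity
  field_simp

/-- The probability generating function of the device-biased cell load. -/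
lemma hasSum_deviceBiasedLoad {x s : ℝ} (hx : 0 ≤ x) (hs : 0 ≤ s) (hs1 : s ≤ 1) :
    HasSum (fun n => deviceBiasedLoad x n * s ^ n)
      ((1 + x * (1 - s) / voronoiConst) ^ (-voronoiConst - 1)) := by
  have hc : 0 < voronoiConst := by norm_num [voronoiConst]
  set c := voronoiConst with hcdef
  -- The `n`-dependent powers of the load law and `s ^ n` combine to `t ^ n`; the remaining
  -- prefactor is `(c / (x + c)) ^ (c + 1)`.
  set t := s * x / (x + c) with ht
  have ht0 : 0 ≤ t := by positivity
  have ht1 : t < 1 := by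
    rw [ht, div_lt_one (by positivity)]
    nlinarith
  have h1 := (Real.one_div_one_sub_rpow_hasFPowerSeriesOnBall_zero (c + 1)).hasSum (y := t) (by
    simp [abs_of_nonneg ht0, ht1, enorm_eq_nnnorm, ← NNReal.coe_lt_coe])
  simp only [zero_add, FormalMultilinearSeries.ofScalars_apply_eq, smul_eq_mul] at h1
  have h2 := h1.mul_left ((c / (x + c)) ^ (c + 1))
  convert! h2 using 1
  · funext n
    rw [choose_eq_Gamma_div (by positivity), deviceBiasedLoad, ← hcdef, ht, div_pow, mul_pow,
      Real.div_rpow hc.le (by positivity), add_assoc (n : ℝ) c 1, Real.rpow_add (by positivity) (n : ℝ),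
      Real.rpow_natCast]
    have := (Real.Gamma_pos_of_pos (show 0 < c + 1 by positivity)).ne'
    have := (Real.Gamma_pos_of_pos (show 0 < (n : ℝ) + 1 by positivity)).ne'
    field_simp
  · rw [mul_one_div, ← Real.div_rpow (by positivity) (by linarith),
      show -c - 1 = -(c + 1) by ring, Real.rpow_neg (by
        have : 0 ≤ 1 - s := by linarith
        positivity), ← Real.inv_rpow (by
        have : 0 ≤ 1 - s := by linarith
        positivity)]
    congr 1
    have h3 : x + c - s * x ≠ 0 := by nlinarith
    have h4 : c + x * (1 - s) ≠ 0 := by nlinarith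
    rw [ht, show 1 - s * x / (x + c) = (x + c - s * x) / (x + c) by field_simp,
      show 1 + x * (1 - s) / c = (x + c - s * x) / c by field_simp; ring]
    field_simp

/-! ### Radial integrals in the plane -/

lemma lintegral_radial {g : ℝ → ℝ} (hg : ∀ y, 0 ≤ g y)
    (hi : IntegrableOn (fun y => y * g y) (Ioi 0)) :
    ∫⁻ u : Plane, ENNReal.ofReal (g ‖u‖) = ENNReal.ofReal (2 * Real.pi * ∫ y in Ioi 0, y * g y) := by
  have hd : Module.finrank ℝ Plane = 2 := by simp
  have hint : Integrable (fun u : Plane => g ‖u‖) := by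
    rw [integrable_fun_norm_addHaar, hd]
    simpa using hi
  rw [← ofReal_integral_eq_lintegral_ofReal hint (Filter.Eventually.of_forall fun u => hg _),
    integral_fun_norm_addHaar, hd]
  congr 1
  have : (volume : Measure Plane).real (Metric.ball 0 1) = Real.pi := by
    simp [Measure.real, EuclideanSpace.volume_ball_fin_two, ENNReal.toReal_ofReal Real.pi_pos.le]
  rw [this]
  simp [mul_assoc]

lemma integrableOn_div_one_add_rpow {α b : ℝ} (hα : 2 < α) (hb : 0 < b) :
    IntegrableOn (fun y : ℝ => y / (1 + y ^ α)) (Ioi b) := by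
  refine Integrable.mono' (integrableOn_Ioi_rpow_of_lt (a := 1 - α) (by linarith) hb)
    (Measurable.aestronglyMeasurable (by fun_prop)) ?_
  refine (ae_restrict_iff' measurableSet_Ioi).2 (Filter.Eventually.of_forall fun y hy => ?_)
  have hy0 : 0 < y := hb.trans hy
  have := Real.rpow_pos_of_pos hy0 α
  rw [Real.norm_of_nonneg (by positivity), Real.rpow_sub hy0, Real.rpow_one]
  gcongr
  linarith

/-- Substitute `‖u‖ = k y` with `k = r γ^(1/α)`: the integrand becomes `1/(1 + y^α)`, the lower
limit `r/k = γ^(-1/α)` no longer depends on `r`, and the planar Jacobian `k² = γ^(2/α) r²` carries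
all of the dependence on `r`. -/
lemma lintegral_outside_ball {α γ r : ℝ} (hα : 2 < α) (hγ : 0 < γ) (hr : 0 ≤ r) :
    ∫⁻ u : Plane, (if r < ‖u‖ then
        1 - ENNReal.ofReal (1 / (1 + γ * r ^ α * ‖u‖ ^ (-α))) else 0) =
      ENNReal.ofReal (2 * Real.pi * γ ^ (2 / α) *
        ∫ y in Ioi (γ ^ (-1 / α)), y / (1 + y ^ α)) * ENNReal.ofReal (r ^ 2) := by
  have hα0 : α ≠ 0 := by linarith
  rcases hr.eq_or_lt with rfl | hr0
  · simp [Real.zero_rpow hα0]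
  set k := r * γ ^ (1 / α) with hk
  have hk0 : 0 < k := by positivity
  have hkα : k ^ α = γ * r ^ α := by
    rw [hk, Real.mul_rpow hr0.le (by positivity), ← Real.rpow_mul hγ.le, one_div_mul_cancel hα0,
      Real.rpow_one, mul_comm]
  have hrk : r * k⁻¹ = γ ^ (-1 / α) := by
    rw [hk, neg_div, Real.rpow_neg hγ.le]
    field_simp
  have hk2 : k ^ 2 = γ ^ (2 / α) * r ^ 2 := by
    rw [hk, mul_pow, ← Real.rpow_natCast (γ ^ (1 / α)), ← Real.rpow_mul hγ.le, mul_comm]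
    congr 2
    push_cast; ring
  let F : ℝ → ℝ := fun y => y / (1 + y ^ α)
  let g : ℝ → ℝ := (Ioi r).indicator fun y => 1 / (1 + (y * k⁻¹) ^ α)
  have hg : ∀ y, 0 ≤ g y := fun y => indicator_nonneg (fun y hy => by
    have : 0 < y := hr0.trans hy
    positivity) y
  have hfun : ∀ y, y * g y = (Ioi r).indicator (fun y => k * F (y * k⁻¹)) y := by
    intro y
    by_cases hy : y ∈ Ioi r
    · simp only [g, F, indicator_of_mem hy]
      field_simp
    · simp only [g, indicator_of_notMem hy, mul_zero]
  have hFi : IntegrableOn (fun y => k * F (y * k⁻¹)) (Ioi r) := by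
    refine Integrable.const_mul ?_ k
    have h3 := (integrableOn_Ioi_comp_mul_right_iff F r (inv_pos.2 hk0)).2
      (integrableOn_div_one_add_rpow hα (by positivity))
    exact h3
  have hgi : IntegrableOn (fun y => y * g y) (Ioi 0) := by
    simp_rw [hfun]
    exact ((integrable_indicator_iff measurableSet_Ioi).2 hFi).integrableOn
  have hlhs : ∀ u : Plane, (if r < ‖u‖ then
        1 - ENNReal.ofReal (1 / (1 + γ * r ^ α * ‖u‖ ^ (-α))) else 0) = ENNReal.ofReal (g ‖u‖) := by
    intro u
    split_ifs with hu
    · have hu0 : 0 < ‖u‖ := hr0.trans hu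
      have hp := Real.rpow_pos_of_pos hu0 α
      have hp2 := Real.rpow_pos_of_pos hk0 α
      simp only [g, indicator_of_mem (mem_Ioi.2 hu)]
      rw [← ENNReal.ofReal_one, ← ENNReal.ofReal_sub _ (by positivity), ← hkα,
        Real.mul_rpow hu0.le (by positivity), Real.inv_rpow hk0.le, Real.rpow_neg hu0.le]
      congr 1
      field_simp
      ring
    · simp only [g, indicator_of_notMem (show ‖u‖ ∉ Ioi r from hu), ENNReal.ofReal_zero]
  simp_rw [hlhs]
  rw [lintegral_radial hg hgi, ← ENNReal.ofReal_mul' (by positivity)]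
  congr 1
  simp_rw [hfun]
  rw [setIntegral_indicator measurableSet_Ioi, Ioi_inter_Ioi, sup_eq_right.2 hr0.le,
    integral_const_mul, integral_comp_mul_right_Ioi F r (inv_pos.2 hk0), hrk, inv_inv, smul_eq_mul]
  have : k * (k * ∫ y in Ioi (γ ^ (-1 / α)), F y) = k ^ 2 * ∫ y in Ioi (γ ^ (-1 / α)), F y := by ring
  rw [this, hk2]
  ring

/-! ### Distance to the nearest point of a planar Poisson process -/

lemma IsPoissonProcess.measure_void {Ω E : Type*} [MeasurableSpace Ω] [MeasurableSpace E]
    {Φ : Ω → Set E} {Λ : Measure E} {P : Measure Ω} (h : IsPoissonProcess Φ Λ P) {B : Set E}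
    (hB : MeasurableSet B) (hΛ : Λ B < ∞) : P {ω | Φ ω ∩ B = ∅} = expNeg (Λ B) := by
  have h1 := (h.law_count B hB hΛ).measure_eq (p := fun n => n = 0) MeasurableSet.of_discrete
  simp only [encard_eq_zero] at h1
  rw [h1, Measure.map_apply Measurable.of_discrete MeasurableSet.of_discrete]
  have h2 : (fun k : ℕ => (k : ℕ∞)) ⁻¹' {x | x = 0} = {0} := by ext; simp
  rw [h2, poissonMeasure_singleton]
  conv_rhs => rw [← ENNReal.ofReal_toReal hΛ.ne, expNeg_ofReal ENNReal.toReal_nonneg]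
  simp [ENNReal.toReal]

section Contact

variable {Ω : Type*} [MeasurableSpace Ω] {P : Measure Ω} {Φ : Ω → Set Plane} {lam : ℝ}

lemma IsPoissonProcess.measure_void_ball (hlam : 0 < lam)
    (h : IsPoissonProcess Φ (ENNReal.ofReal lam • (volume : Measure Plane)) P) {t : ℝ} (ht : 0 ≤ t) :
    P {ω | Φ ω ∩ Metric.ball 0 t = ∅} = ENNReal.ofReal (Real.exp (-(lam * Real.pi * t ^ 2))) := by
  have h1 : (ENNReal.ofReal lam • (volume : Measure Plane)) (Metric.ball 0 t) =
      ENNReal.ofReal (lam * Real.pi * t ^ 2) := by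
    rw [Measure.smul_apply, EuclideanSpace.volume_ball_fin_two, smul_eq_mul,
      ← ENNReal.ofReal_pow ht, ← ENNReal.ofReal_mul (by positivity), ← ENNReal.ofReal_mul hlam.le]
    congr 1; ring
  rw [h.measure_void Metric.isOpen_ball.measurableSet (by rw [h1]; exact ENNReal.ofReal_lt_top), h1,
    expNeg_ofReal (by positivity)]

/-- `Metric.infDist` to the empty set is `0`, so emptiness must be excluded before `t ≤ infDist` can
be read as a void event. The void probabilities of growing balls tend to `0`. -/
lemma IsPoissonProcess.ae_nonempty (hlam : 0 < lam)
    (h : IsPoissonProcess Φ (ENNReal.ofReal lam • (volume : Measure Plane)) P) :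
    ∀ᵐ ω ∂P, (Φ ω).Nonempty := by
  have hle : ∀ n : ℕ, P {ω | ¬ (Φ ω).Nonempty} ≤
      ENNReal.ofReal (Real.exp (-(lam * Real.pi * (n : ℝ) ^ 2))) := by
    intro n
    rw [← h.measure_void_ball hlam n.cast_nonneg]
    refine measure_mono fun ω hω => ?_
    simp only [mem_ofPred_eq, not_nonempty_iff_eq_empty] at hω ⊢
    simp [hω]
  have hlim : Filter.Tendsto (fun n : ℕ => ENNReal.ofReal (Real.exp (-(lam * Real.pi * (n : ℝ) ^ 2))))
      Filter.atTop (nhds 0) := by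
    rw [← ENNReal.ofReal_zero]
    refine (ENNReal.continuous_ofReal.tendsto 0).comp (Real.tendsto_exp_neg_atTop_nhds_zero.comp ?_)
    refine Filter.Tendsto.const_mul_atTop (by positivity) ?_
    exact (Filter.tendsto_pow_atTop two_ne_zero).comp tendsto_natCast_atTop_atTop
  exact le_antisymm (ge_of_tendsto' hlim hle) zero_le

lemma IsPoissonProcess.measurable_infDist
    (h : IsPoissonProcess Φ (ENNReal.ofReal lam • (volume : Measure Plane)) P) :
    Measurable fun ω => Metric.infDist (0 : Plane) (Φ ω) := by
  have hm : ∀ B : Set Plane, MeasurableSet B → MeasurableSet {ω | Φ ω ∩ B = ∅} := by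
    intro B hB
    have := h.measurable_count B hB (MeasurableSet.of_discrete (s := {0}))
    convert! this using 1
    ext ω; simp
  refine measurable_of_Iio fun t => ?_
  rcases le_or_gt t 0 with ht | ht
  · convert! MeasurableSet.empty
    ext ω
    simp only [mem_preimage, mem_Iio, mem_empty_iff_false, iff_false, not_lt]
    exact ht.trans Metric.infDist_nonneg
  -- The second event, no points at all, belongs here because `infDist` is then `0 < t`.
  · convert! (hm (Metric.ball 0 t) Metric.isOpen_ball.measurableSet).compl.union
      (hm _ MeasurableSet.univ) using 1
    ext ω
    simp only [mem_preimage, mem_Iio, mem_union, mem_compl_iff, mem_ofPred_eq, inter_univ]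
    by_cases hne : (Φ ω).Nonempty
    · rw [Metric.infDist_lt_iff hne]
      simp only [hne.ne_empty, or_false, ← ne_eq, ← nonempty_iff_ne_empty]
      simp [Set.Nonempty, dist_comm]
    · rw [not_nonempty_iff_eq_empty] at hne
      simp [hne, ht]

lemma lintegral_exp_neg_mul_sq_mul {b : ℝ} (hb : 0 < b) :
    ∫⁻ t in Ioi (0 : ℝ), ENNReal.ofReal (Real.exp (-(b * t ^ 2)) * t) =
      ENNReal.ofReal (1 / (2 * b)) := by
  have hd : ∀ t : ℝ, HasDerivAt (fun t => -(1 / (2 * b)) * Real.exp (-(b * t ^ 2)))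
      (Real.exp (-(b * t ^ 2)) * t) t := by
    intro t
    have h1 : HasDerivAt (fun t : ℝ => -(b * t ^ 2)) (-(b * (2 * t))) t := by
      convert! (((hasDerivAt_id t).pow 2).const_mul b).neg using 1
      simp
    convert! h1.exp.const_mul (-(1 / (2 * b))) using 1
    field_simp
  have hlim : Filter.Tendsto (fun t : ℝ => -(1 / (2 * b)) * Real.exp (-(b * t ^ 2))) Filter.atTop
      (nhds 0) := by
    rw [← mul_zero (-(1 / (2 * b)))]
    refine Filter.Tendsto.const_mul _ (Real.tendsto_exp_neg_atTop_nhds_zero.comp ?_)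
    exact Filter.Tendsto.const_mul_atTop hb (Filter.tendsto_pow_atTop two_ne_zero)
  have hnn : ∀ t ∈ Ioi (0 : ℝ), 0 ≤ Real.exp (-(b * t ^ 2)) * t := fun t ht =>
    mul_nonneg (Real.exp_pos _).le (le_of_lt ht)
  have hint := integrableOn_Ioi_deriv_of_nonneg' (fun t _ => hd t) hnn hlim
  rw [← ofReal_integral_eq_lintegral_ofReal hint
    ((ae_restrict_iff' measurableSet_Ioi).2 (Filter.Eventually.of_forall hnn)),
    integral_Ioi_of_hasDerivAt_of_nonneg' (fun t _ => hd t) hnn hlim]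
  simp

/-- Layer cake: the second moment is `2 ∫ t P(t ≤ R) dt`, and for `t > 0` the tail of the distance
`R` is the void probability `exp (-λ π t²)`. -/
lemma IsPoissonProcess.lintegral_infDist_sq (hlam : 0 < lam)
    (h : IsPoissonProcess Φ (ENNReal.ofReal lam • (volume : Measure Plane)) P) :
    ∫⁻ ω, ENNReal.ofReal (Metric.infDist (0 : Plane) (Φ ω) ^ 2) ∂P =
      ENNReal.ofReal (1 / (Real.pi * lam)) := by
  have h1 := lintegral_rpow_eq_lintegral_meas_le_mul P
    (Filter.Eventually.of_forall fun ω => Metric.infDist_nonneg (x := (0 : Plane)) (s := Φ ω))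
    h.measurable_infDist.aemeasurable two_pos
  simp only [Real.rpow_two] at h1
  rw [h1]
  have h2 : ∀ t ∈ Ioi (0 : ℝ), P {ω | t ≤ Metric.infDist (0 : Plane) (Φ ω)} *
      ENNReal.ofReal (t ^ ((2 : ℝ) - 1)) =
      ENNReal.ofReal (Real.exp (-(lam * Real.pi * t ^ 2)) * t) := by
    intro t ht
    rw [ENNReal.ofReal_mul (Real.exp_pos _).le, ← h.measure_void_ball hlam (le_of_lt ht)]
    congr 1
    · refine measure_congr ?_
      filter_upwards [h.ae_nonempty hlam] with ω hω
      refine propext ?_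
      change t ≤ Metric.infDist 0 (Φ ω) ↔ Φ ω ∩ Metric.ball 0 t = ∅
      rw [← not_iff_not, not_le, Metric.infDist_lt_iff hω, ← ne_eq, ← nonempty_iff_ne_empty]
      simp [Set.Nonempty, dist_comm]
    · norm_num
  rw [setLIntegral_congr_fun measurableSet_Ioi h2, lintegral_exp_neg_mul_sq_mul (by positivity),
    ← ENNReal.ofReal_mul (by norm_num)]
  congr 1
  field_simp

end Contact

/-! ### Independence -/

lemma measure_le_ofReal_of_indepFun {Ω : Type*} [MeasurableSpace Ω] {P : Measure Ω}
    [IsProbabilityMeasure P] {W : Ω → ℝ≥0∞} {h : Ω → ℝ} (hW : Measurable W)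
    (hh : HasLaw h (expMeasure 1) P) (hind : IndepFun W h P) :
    P {ω | W ω ≤ ENNReal.ofReal (h ω)} = ∫⁻ ω, expNeg (W ω) ∂P := by
  have hs : MeasurableSet {p : ℝ≥0∞ × ℝ | p.1 ≤ ENNReal.ofReal p.2} :=
    measurableSet_le measurable_fst measurable_snd.ennreal_ofReal
  have h1 : P {ω | W ω ≤ ENNReal.ofReal (h ω)} =
      (P.map fun ω => (W ω, h ω)) {p | p.1 ≤ ENNReal.ofReal p.2} := by
    rw [Measure.map_apply_of_aemeasurable (hW.aemeasurable.prodMk hh.aemeasurable) hs]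
    rfl
  rw [h1, (indepFun_iff_map_prod_eq_prod_map_map hW.aemeasurable hh.aemeasurable).1 hind,
    hh.map_eq, Measure.prod_apply hs, ← lintegral_map measurable_expNeg hW]
  exact lintegral_congr fun w => expMeasure_le_ofReal w

lemma lintegral_indepFun {Ω A B : Type*} [MeasurableSpace Ω] [MeasurableSpace A]
    [MeasurableSpace B] {P : Measure Ω} [IsProbabilityMeasure P] {X : Ω → A} {Y : Ω → B}
    (hX : Measurable X) (hY : Measurable Y) (hind : IndepFun X Y P) {G : A × B → ℝ≥0∞}
    (hG : Measurable G) :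
    ∫⁻ ω, G (X ω, Y ω) ∂P = ∫⁻ ω, ∫⁻ ω', G (X ω, Y ω') ∂P ∂P := by
  rw [← lintegral_map hG (hX.prodMk hY),
    (indepFun_iff_map_prod_eq_prod_map_map hX.aemeasurable hY.aemeasurable).1 hind,
    lintegral_prod _ hG.aemeasurable, lintegral_map hG.lintegral_prod_right' hX]
  exact lintegral_congr fun ω => lintegral_map (hG.comp measurable_prodMk_left) hY

/-! ### Intra-cell interference -/

/-- The active devices among the first `c.1` ones. -/
def activeDevices (c : ℕ × (ℕ → DeviceState)) : Finset ℕ :=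
  (Finset.range c.1).filter fun j => (c.2 j).IsActive

lemma measurable_card_activeDevices : Measurable fun c => (activeDevices c).card := by
  refine measurable_from_prod_countable_right fun n => ?_
  simp only [activeDevices, Finset.card_filter]
  refine Finset.measurable_sum _ fun j _ => ?_
  exact (Measurable.of_discrete (f := fun s : DeviceState => if s.IsActive then 1 else 0)).comp
    (measurable_pi_apply j)

lemma measurable_sum_activeDevices (f : ℝ → ℝ≥0∞) (hf : Measurable f) :
    Measurable fun p : (ℕ × (ℕ → DeviceState)) × (ℕ → ℝ) =>
      ∑ j ∈ activeDevices p.1, f (p.2 j) := by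
  have h1 : ∀ p : (ℕ × (ℕ → DeviceState)) × (ℕ → ℝ), ∑ j ∈ activeDevices p.1, f (p.2 j) =
      -- The index set of the sum is random; a series over all `j` has fixed indices and measurable
      -- conditions.
      ∑' j, if j < p.1.1 ∧ (p.1.2 j).IsActive then f (p.2 j) else 0 := by
    intro p
    rw [tsum_eq_sum (s := activeDevices p.1)]
    · refine Finset.sum_congr rfl fun j hj => ?_
      simp only [activeDevices, Finset.mem_filter, Finset.mem_range] at hj
      rw [if_pos hj]
    · intro j hj
      simp only [activeDevices, Finset.mem_filter, Finset.mem_range] at hj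
      rw [if_neg hj]
  simp_rw [h1]
  refine Measurable.tsum fun j => Measurable.ite ?_ (by fun_prop) measurable_const
  refine MeasurableSet.inter ?_ ?_
  · exact (measurable_fst.comp measurable_fst) (MeasurableSet.of_discrete (s := {n : ℕ | j < n}))
  · have hj : Measurable fun p : (ℕ × (ℕ → DeviceState)) × (ℕ → ℝ) => p.1.2 j := by fun_prop
    exact hj (MeasurableSet.of_discrete (s := {s : DeviceState | s.IsActive}))

lemma lintegral_expNeg_sum_exp {Ω : Type*} [MeasurableSpace Ω] {P : Measure Ω} {h : Ω → ℕ → ℝ}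
    (hm : Measurable h) (hlaw : ∀ j, HasLaw (fun ω => h ω j) (expMeasure 1) P)
    (hind : iIndepFun (fun (j : ℕ) (ω : Ω) => h ω j) P) {a : ℝ} (ha : 0 ≤ a) (A : Finset ℕ) :
    ∫⁻ ω, expNeg (∑ j ∈ A, ENNReal.ofReal (a * h ω j)) ∂P =
      ENNReal.ofReal (1 / (1 + a)) ^ A.card := by
  have hg : Measurable fun t : ℝ => expNeg (ENNReal.ofReal (a * t)) :=
    measurable_expNeg.comp (by fun_prop)
  simp_rw [expNeg_sum]
  rw [lintegral_prod_eq_prod_lintegral_of_indepFun A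
    (fun j ω => expNeg (ENNReal.ofReal (a * h ω j)))
    (hind.comp (fun _ t => expNeg (ENNReal.ofReal (a * t))) fun _ => hg)
    fun j => hg.comp ((measurable_pi_apply j).comp hm)]
  rw [← Finset.prod_const]
  refine Finset.prod_congr rfl fun j _ => ?_
  exact ((hlaw j).lintegral_comp hg.aemeasurable).trans (lintegral_expNeg_expMeasure ha)

namespace RachNetwork

variable (net : RachNetwork)

lemma T_nonneg (m : ℕ) : 0 ≤ net.T m := measureReal_nonneg

lemma R_nonneg (m : ℕ) : 0 ≤ net.R m := measureReal_nonneg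

lemma lamDp_nonneg : 0 ≤ net.lamDp := div_nonneg net.lamD_pos.le (Nat.cast_nonneg _)

instance (m : ℕ) : IsProbabilityMeasure (net.queueLaw m) := net.prob_queue m

instance (m : ℕ) : IsProbabilityMeasure (net.accessLaw m) := net.prob_access m

instance (m : ℕ) : IsProbabilityMeasure (net.stateLaw m) := by
  unfold stateLaw; infer_instance

lemma uniformOn_preamble (p₀ : Fin net.xi) :
    uniformOn (univ : Set (Fin net.xi)) {p₀} = ENNReal.ofReal (1 / net.xi) := by
  rw [uniformOn_univ]
  simp [ENNReal.ofReal_inv_of_pos (Nat.cast_pos.2 net.xi_pos)]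

instance : IsProbabilityMeasure (uniformOn (univ : Set (Fin net.xi))) := by
  have : Nonempty (Fin net.xi) := ⟨⟨0, net.xi_pos⟩⟩
  exact isProbabilityMeasure_uniformOn finite_univ univ_nonempty

lemma stateLaw_isActive (m : ℕ) :
    net.stateLaw m {s | s.IsActive} = ENNReal.ofReal (net.T m * net.R m) := by
  have h1 : {s : DeviceState | s.IsActive} = {q : ℕ × ℕ | 0 < q.1 + q.2} ×ˢ {true} := by
    ext s; simp [DeviceState.IsActive]
  rw [h1, stateLaw, Measure.prod_prod, ENNReal.ofReal_mul (net.T_nonneg m), T, R,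
    ofReal_measureReal, ofReal_measureReal]

/-! ### Inter-cell interference -/

/-- Contribution of a deployed device to the inter-cell interference, times `γ / ρ`. -/
def contribution (p₀ : Fin net.xi) (d : net.Device) : ℝ≥0∞ :=
  if d.2.1 = p₀ ∧ d.2.2.2.2.IsActive ∧ d.2.2.1 < ‖d.1‖ then
    ENNReal.ofReal (net.gammaTh * d.2.2.1 ^ net.alpha * ‖d.1‖ ^ (-net.alpha) * d.2.2.2.1) else 0

lemma measurable_contribution (p₀ : Fin net.xi) : Measurable (net.contribution p₀) := by
  refine Measurable.ite ?_ (by fun_prop) measurable_const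
  refine MeasurableSet.inter ?_ (MeasurableSet.inter ?_ ?_)
  · exact (measurable_fst.comp measurable_snd) (measurableSet_singleton p₀)
  · exact (measurable_snd.comp (measurable_snd.comp (measurable_snd.comp measurable_snd)))
      (MeasurableSet.of_discrete (s := {s : DeviceState | s.IsActive}))
  · have h1 : Measurable fun d : net.Device => d.2.2.1 := by fun_prop
    have h2 : Measurable fun d : net.Device => ‖d.1‖ := by fun_prop
    exact measurableSet_lt h1 h2

lemma lintegral_contribution (p₀ : Fin net.xi) (m : ℕ) {μ : Measure ℝ} [IsProbabilityMeasure μ]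
    (hμ : ∀ᵐ r ∂μ, 0 ≤ r) :
    ∫⁻ d, (1 - expNeg (net.contribution p₀ d)) ∂(net.deviceIntensity μ m) =
      ENNReal.ofReal net.lamD * ENNReal.ofReal (1 / net.xi) * ENNReal.ofReal (net.T m * net.R m) *
      (ENNReal.ofReal (2 * Real.pi * net.gammaTh ^ (2 / net.alpha) *
        ∫ y in Ioi (net.gammaTh ^ (-1 / net.alpha)), y / (1 + y ^ net.alpha)) *
      ∫⁻ r, ENNReal.ofReal (r ^ 2) ∂μ) := by
  have hF : Measurable fun d => 1 - expNeg (net.contribution p₀ d) :=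
    (measurable_expNeg.comp (net.measurable_contribution p₀)).const_sub 1
  -- `H u r` is what remains of the integrand once the gain is averaged and the factors from
  -- preamble and state are split off.
  set H : Plane → ℝ → ℝ≥0∞ := fun u r => if r < ‖u‖ then
    1 - ENNReal.ofReal (1 / (1 + net.gammaTh * r ^ net.alpha * ‖u‖ ^ (-net.alpha))) else 0 with hH
  have hHm : Measurable fun q : Plane × ℝ => H q.1 q.2 := by
    refine Measurable.ite (measurableSet_lt (by fun_prop) (by fun_prop)) ?_ measurable_const
    exact Measurable.const_sub (by fun_prop) 1
  have hstate : ∀ (u : Plane) (p : Fin net.xi) (r h : ℝ),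
      ∫⁻ s, (1 - expNeg (net.contribution p₀ (u, p, r, h, s))) ∂(net.stateLaw m) =
      ENNReal.ofReal (net.T m * net.R m) * (if p = p₀ then 1 else 0) *
        if r < ‖u‖ then
          1 - expNeg (ENNReal.ofReal (net.gammaTh * r ^ net.alpha * ‖u‖ ^ (-net.alpha) * h))
        else 0 := by
    intro u p r h
    have h1 : ∀ s : DeviceState, 1 - expNeg (net.contribution p₀ (u, p, r, h, s)) =
        ({s : DeviceState | s.IsActive}.indicator (fun _ => (if p = p₀ then 1 else 0) *
        if r < ‖u‖ then
          1 - expNeg (ENNReal.ofReal (net.gammaTh * r ^ net.alpha * ‖u‖ ^ (-net.alpha) * h))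
        else 0) s) := by
      intro s
      by_cases hp : p = p₀ <;> by_cases hs : s.IsActive <;> by_cases hr : r < ‖u‖ <;>
        simp [contribution, hp, hs, hr, expNeg_zero]
    simp_rw [h1]
    rw [lintegral_indicator_const MeasurableSet.of_discrete, stateLaw_isActive]
    ring
  have hgain : ∀ (u : Plane) (p : Fin net.xi) (r : ℝ), 0 ≤ r →
      ∫⁻ h, (ENNReal.ofReal (net.T m * net.R m) * (if p = p₀ then 1 else 0) *
        if r < ‖u‖ then
          1 - expNeg (ENNReal.ofReal (net.gammaTh * r ^ net.alpha * ‖u‖ ^ (-net.alpha) * h))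
        else 0) ∂(expMeasure 1) =
      ENNReal.ofReal (net.T m * net.R m) * (if p = p₀ then 1 else 0) * H u r := by
    intro u p r hr
    have hnn : 0 ≤ net.gammaTh * r ^ net.alpha * ‖u‖ ^ (-net.alpha) :=
      mul_nonneg (mul_nonneg net.gammaTh_pos.le (Real.rpow_nonneg hr _))
        (Real.rpow_nonneg (norm_nonneg _) _)
    have hem : Measurable fun h : ℝ => expNeg
        (ENNReal.ofReal (net.gammaTh * r ^ net.alpha * ‖u‖ ^ (-net.alpha) * h)) :=
      measurable_expNeg.comp (by fun_prop)
    by_cases hru : r < ‖u‖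
    · simp only [hH, hru, if_true]
      rw [lintegral_const_mul _ (hem.const_sub 1), lintegral_sub hem _
        (Filter.Eventually.of_forall fun _ => expNeg_le_one _), lintegral_expNeg_expMeasure hnn]
      · simp
      · rw [lintegral_expNeg_expMeasure hnn]; exact ENNReal.ofReal_ne_top
    · simp [hH, hru]
  have hinner : ∀ (u : Plane) (p : Fin net.xi),
      ∫⁻ x, (1 - expNeg (net.contribution p₀ (u, p, x)))
        ∂(μ.prod ((expMeasure 1).prod (net.stateLaw m))) =
      (if p = p₀ then 1 else 0) * (ENNReal.ofReal (net.T m * net.R m) * ∫⁻ r, H u r ∂μ) := by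
    intro u p
    have hm1 : Measurable fun x => 1 - expNeg (net.contribution p₀ (u, p, x)) :=
      hF.comp (by fun_prop)
    rw [lintegral_prod _ hm1.aemeasurable]
    have h1 : ∀ᵐ r ∂μ, ∫⁻ y, (1 - expNeg (net.contribution p₀ (u, p, r, y)))
        ∂((expMeasure 1).prod (net.stateLaw m)) =
        ENNReal.ofReal (net.T m * net.R m) * (if p = p₀ then 1 else 0) * H u r := by
      filter_upwards [hμ] with r hr
      have hm2 : Measurable fun y => 1 - expNeg (net.contribution p₀ (u, p, r, y)) :=
        hm1.comp (by fun_prop)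
      rw [lintegral_prod _ hm2.aemeasurable]
      simp_rw [hstate]
      exact hgain u p r hr
    have hHu : Measurable fun r => H u r := hHm.comp measurable_prodMk_left
    rw [lintegral_congr_ae h1, lintegral_const_mul _ hHu]
    ring
  have hplane : ∀ u : Plane, ∫⁻ x, (1 - expNeg (net.contribution p₀ (u, x)))
      ∂((uniformOn (univ : Set (Fin net.xi))).prod
        (μ.prod ((expMeasure 1).prod (net.stateLaw m)))) =
      ENNReal.ofReal (1 / net.xi) * (ENNReal.ofReal (net.T m * net.R m) * ∫⁻ r, H u r ∂μ) := by
    intro u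
    have hm1 : Measurable fun x => 1 - expNeg (net.contribution p₀ (u, x)) :=
      hF.comp (by fun_prop)
    rw [lintegral_prod _ hm1.aemeasurable]
    simp_rw [hinner]
    rw [lintegral_mul_const _ Measurable.of_discrete, ← uniformOn_preamble net p₀]
    congr 1
    rw [← lintegral_indicator_one (measurableSet_singleton p₀)]
    refine lintegral_congr fun p => ?_
    by_cases hp : p = p₀ <;> simp [hp]
  have hHr : Measurable fun u => ∫⁻ r, H u r ∂μ := hHm.lintegral_prod_right'
  rw [deviceIntensity, lintegral_prod _ hF.aemeasurable]
  simp_rw [hplane]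
  rw [lintegral_smul_measure, lintegral_const_mul _ (hHr.const_mul _), lintegral_const_mul _ hHr,
    -- With the location integrated first, at fixed `r`, `lintegral_outside_ball` applies.
    lintegral_lintegral_swap hHm.aemeasurable]
  have h2 : ∀ᵐ r ∂μ, ∫⁻ u, H u r =
      ENNReal.ofReal (2 * Real.pi * net.gammaTh ^ (2 / net.alpha) *
        ∫ y in Ioi (net.gammaTh ^ (-1 / net.alpha)), y / (1 + y ^ net.alpha)) *
        ENNReal.ofReal (r ^ 2) := by
    filter_upwards [hμ] with r hr
    exact lintegral_outside_ball net.two_lt_alpha net.gammaTh_pos hr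
  rw [lintegral_congr_ae h2, lintegral_const_mul _ (by fun_prop), smul_eq_mul]
  ring

namespace Slot

variable {net} {m : ℕ} {p₀ : Fin net.xi} {Ω : Type*} [MeasurableSpace Ω] {P : Measure Ω}
  (S : net.Slot m p₀ Ω P)

/-- The selection of interferers moves from the index set into the summand, giving a sum over the
whole Poisson process, as the Laplace functional requires. -/
lemma scaled_inter (ω : Ω) :
    ENNReal.ofReal (net.gammaTh / net.rho) * S.inter ω =
      ∑' d : S.devices ω, net.contribution p₀ d := by
  have h1 : ∀ d : net.Device, ENNReal.ofReal (net.gammaTh / net.rho) *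
      (S.out ω).indicator (fun d => if d.state.IsActive then
        ENNReal.ofReal (d.power * d.gain * ‖d.loc‖ ^ (-net.alpha)) else 0) d =
      (S.devices ω).indicator (net.contribution p₀) d := by
    intro d
    have hρ := net.rho_pos.ne'
    have hval : ENNReal.ofReal (net.gammaTh / net.rho) *
        ENNReal.ofReal (d.power * d.gain * ‖d.loc‖ ^ (-net.alpha)) =
        ENNReal.ofReal (net.gammaTh * d.2.2.1 ^ net.alpha * ‖d.1‖ ^ (-net.alpha) * d.2.2.2.1) := by
      rw [← ENNReal.ofReal_mul (div_nonneg net.gammaTh_pos.le net.rho_pos.le)]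
      congr 1
      simp only [Device.power, Device.gain, Device.loc, Device.dist]
      field_simp
    by_cases hd : d ∈ S.devices ω
    · by_cases ho : d ∈ S.out ω
      · obtain ⟨_, hp, hr⟩ := ho
        have ho : d ∈ S.out ω := ⟨hd, hp, hr⟩
        rw [indicator_of_mem hd, indicator_of_mem ho, contribution]
        by_cases hs : d.state.IsActive
        · rw [if_pos hs, if_pos ⟨hp, hs, hr⟩, hval]
        · rw [if_neg hs, if_neg fun h => hs h.2.1, mul_zero]
      · rw [indicator_of_mem hd, indicator_of_notMem ho, contribution,
          if_neg fun h => ho ⟨hd, h.1, h.2.2⟩, mul_zero]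
    · rw [indicator_of_notMem hd, indicator_of_notMem fun ho => hd ho.1, mul_zero]
  rw [inter, tsum_subtype (S.out ω) (fun d => if d.state.IsActive then
        ENNReal.ofReal (d.power * d.gain * ‖d.loc‖ ^ (-net.alpha)) else 0),
    ← ENNReal.tsum_mul_left, tsum_subtype (S.devices ω) (net.contribution p₀)]
  exact tsum_congr h1

lemma scaled_intra (ω : Ω) :
    ENNReal.ofReal (net.gammaTh / net.rho) * S.intra ω =
      ∑ j ∈ activeDevices (S.cell ω), ENNReal.ofReal (net.gammaTh * S.h ω j) := by
  have hρ := net.rho_pos.ne'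
  rw [intra, Finset.mul_sum, activeDevices, Finset.sum_filter]
  refine Finset.sum_congr rfl fun j _ => ?_
  split_ifs
  · rw [← ENNReal.ofReal_mul (div_nonneg net.gammaTh_pos.le net.rho_pos.le)]
    congr 1
    field_simp
  · rw [mul_zero]

/-- Laplace transform of the inter-cell interference. -/
lemma lintegral_expNeg_inter [IsProbabilityMeasure P] :
    ∫⁻ ω, expNeg (ENNReal.ofReal (net.gammaTh / net.rho) * S.inter ω) ∂P =
      ENNReal.ofReal (Real.exp (-(2 * net.gammaTh ^ (2 / net.alpha) *
        (net.T m * net.R m * net.lamDp / net.lamB) *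
          ∫ y in Ioi (net.gammaTh ^ (-1 / net.alpha)), y / (1 + y ^ net.alpha)))) := by
  have hmeas := S.bs_poisson.measurable_infDist
  have hprob : IsProbabilityMeasure (P.map fun ω => Metric.infDist (0 : Plane) (S.bs ω)) :=
    Measure.isProbabilityMeasure_map hmeas.aemeasurable
  have hsf : SigmaFinite (net.deviceIntensity
      (P.map fun ω => Metric.infDist (0 : Plane) (S.bs ω)) m) := by
    unfold deviceIntensity
    have : SigmaFinite (ENNReal.ofReal net.lamD • (volume : Measure Plane)) := by
      unfold ENNReal.ofReal
      exact inferInstanceAs (SigmaFinite (net.lamD.toNNReal • (volume : Measure Plane)))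
    infer_instance
  have hB := net.lamB_pos
  have hD := net.lamD_pos
  have hγ := net.gammaTh_pos
  have hT := net.T_nonneg m
  have hR := net.R_nonneg m
  have hξ : (0 : ℝ) < net.xi := Nat.cast_pos.2 net.xi_pos
  have hDp := net.lamDp_nonneg
  have hI : 0 ≤ ∫ y in Ioi (net.gammaTh ^ (-1 / net.alpha)), y / (1 + y ^ net.alpha) := by
    refine setIntegral_nonneg measurableSet_Ioi fun y hy => ?_
    have : 0 < y := (Real.rpow_pos_of_pos hγ _).trans hy
    positivity
  simp_rw [scaled_inter]
  rw [S.devices_poisson.lintegral_expNeg_tsum (net.measurable_contribution p₀),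
    lintegral_contribution, lintegral_map (by fun_prop) hmeas, S.bs_poisson.lintegral_infDist_sq hB,
    ← ENNReal.ofReal_mul (by positivity), ← ENNReal.ofReal_mul (by positivity),
    ← ENNReal.ofReal_mul (by positivity), ← ENNReal.ofReal_mul (by positivity),
    expNeg_ofReal (by positivity), lamDp]
  -- The `2π` from polar coordinates meets `1/(π λ_B)` from the contact distance, so `π` cancels.
  · congr 3
    have := Real.pi_pos.ne'
    field_simp
  · rw [ae_map_iff hmeas.aemeasurable measurableSet_Ici]
    exact Filter.Eventually.of_forall fun ω => Metric.infDist_nonneg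

/-- Laplace transform of the intra-cell interference. -/
lemma lintegral_expNeg_intra [IsProbabilityMeasure P] :
    ∫⁻ ω, expNeg (ENNReal.ofReal (net.gammaTh / net.rho) * S.intra ω) ∂P =
      ENNReal.ofReal ((1 + net.T m * net.R m * net.lamDp * net.gammaTh /
        (voronoiConst * net.lamB * (1 + net.gammaTh))) ^ (-voronoiConst - 1)) := by
  have hγ := net.gammaTh_pos
  have hB := net.lamB_pos
  have hx : 0 ≤ net.T m * net.R m * net.lamDp / net.lamB :=
    div_nonneg (mul_nonneg (mul_nonneg (net.T_nonneg m) (net.R_nonneg m)) net.lamDp_nonneg) hB.le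
  have hind : IndepFun S.cell S.h P := S.indep.indep (i := 2) (j := 1) (by decide)
  have hN : Measurable fun ω => (activeDevices (S.cell ω)).card :=
    measurable_card_activeDevices.comp S.measurable_cell
  simp_rw [scaled_intra]
  -- Freezing the cell configuration makes the set of active devices deterministic while the gains
  -- are averaged.
  rw [lintegral_indepFun S.measurable_cell S.measurable_h hind
    (G := fun p => expNeg (∑ j ∈ activeDevices p.1, ENNReal.ofReal (net.gammaTh * p.2 j)))
    (measurable_expNeg.comp
      (measurable_sum_activeDevices (fun t => ENNReal.ofReal (net.gammaTh * t)) (by fun_prop)))]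
  simp_rw [lintegral_expNeg_sum_exp S.measurable_h S.h_law S.h_indep hγ.le]
  rw [← lintegral_map (f := fun n : ℕ => ENNReal.ofReal (1 / (1 + net.gammaTh)) ^ n)
    Measurable.of_discrete hN, lintegral_countable']
  have h1 : ∀ n : ℕ, ENNReal.ofReal (1 / (1 + net.gammaTh)) ^ n *
      (P.map fun ω => (activeDevices (S.cell ω)).card) {n} =
      ENNReal.ofReal (deviceBiasedLoad (net.T m * net.R m * net.lamDp / net.lamB) n *
        (1 / (1 + net.gammaTh)) ^ n) := by
    intro n
    rw [Measure.map_apply hN (measurableSet_singleton n), ← S.load_law n,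
      ENNReal.ofReal_mul measureReal_nonneg, ofReal_measureReal, ENNReal.ofReal_pow (by positivity),
      mul_comm]
    rfl
  simp_rw [h1]
  have hs := hasSum_deviceBiasedLoad hx (s := 1 / (1 + net.gammaTh)) (by positivity)
    (by rw [div_le_one (by positivity)]; linarith)
  rw [← ENNReal.ofReal_tsum_of_nonneg _ hs.summable, hs.tsum_eq]
  · congr 3
    have : voronoiConst ≠ 0 := by norm_num [voronoiConst]
    field_simp
    ring
  · intro n
    rw [← S.load_law n]
    have := hγ
    positivity

/-- The four independent sources of randomness: the gain of the chosen device, the intra-cell gains,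
the configuration of the cell, and the deployed devices. -/
@[reducible] def sources : Fin 4 → MeasurableSpace Ω :=
  ![MeasurableSpace.comap S.h₀ inferInstance, MeasurableSpace.comap S.h inferInstance,
    MeasurableSpace.comap S.cell inferInstance, countSigma S.devices]

lemma sources_le (i : Fin 4) : S.sources i ≤ (inferInstance : MeasurableSpace Ω) := by
  fin_cases i
  · exact S.measurable_h₀.comap_le
  · exact S.measurable_h.comap_le
  · exact S.measurable_cell.comap_le
  · exact S.devices_poisson.countSigma_le

/-- Mutual independence of the sources passes to σ-algebras generated by disjoint groups of them. -/
lemma indepFun_of_sources {A B : Type*} [MeasurableSpace A] [MeasurableSpace B] {X : Ω → A}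
    {Y : Ω → B} {s t : Set (Fin 4)} (hst : Disjoint s t)
    (hX : Measurable[⨆ i ∈ s, S.sources i] X) (hY : Measurable[⨆ i ∈ t, S.sources i] Y) :
    IndepFun X Y P :=
  indep_of_indep_of_le_left (indep_of_indep_of_le_right
    (indep_iSup_of_disjoint S.sources_le S.indep hst) hY.comap_le) hX.comap_le

lemma measurable_scaled_intra {s : Set (Fin 4)} (h1 : 1 ∈ s) (h2 : 2 ∈ s) :
    Measurable[⨆ i ∈ s, S.sources i]
      fun ω => ENNReal.ofReal (net.gammaTh / net.rho) * S.intra ω := by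
  have hh : Measurable[⨆ i ∈ s, S.sources i] S.h :=
    (comap_measurable S.h).mono (le_iSup₂ (f := fun i (_ : i ∈ s) => S.sources i) 1 h1) le_rfl
  have hc : Measurable[⨆ i ∈ s, S.sources i] S.cell :=
    (comap_measurable S.cell).mono (le_iSup₂ (f := fun i (_ : i ∈ s) => S.sources i) 2 h2) le_rfl
  simp_rw [scaled_intra]
  exact (measurable_sum_activeDevices (fun t => ENNReal.ofReal (net.gammaTh * t))
    (by fun_prop)).comp (hc.prodMk hh)

lemma measurable_scaled_inter {s : Set (Fin 4)} (h3 : 3 ∈ s) :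
    Measurable[⨆ i ∈ s, S.sources i]
      fun ω => ENNReal.ofReal (net.gammaTh / net.rho) * S.inter ω := by
  simp_rw [scaled_inter]
  exact (measurable_tsum_countSigma S.devices (net.measurable_contribution p₀)).mono
    (le_iSup₂ (f := fun i (_ : i ∈ s) => S.sources i) 3 h3) le_rfl

/-- Where `h₀ ≤ 0`, and noise and interference vanish, `0 / 0 = 0` makes the SINR fail although the
rearranged inequality `0 ≤ 0` holds; this null event is set aside. -/
lemma ae_pos_h₀ : ∀ᵐ ω ∂P, 0 < S.h₀ ω := by
  refine (S.h₀_law.ae_iff (p := fun t => 0 < t) (measurableSet_Ioi (a := (0 : ℝ))).mem).2 ?_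
  rw [ae_iff]
  have h1 : {t : ℝ | ¬ 0 < t} = Iic 0 := by ext; simp
  rw [h1, ← ofReal_cdf, cdf_expMeasure_eq one_pos]
  simp

/-- The preamble transmission succeeds exactly if the gain of the chosen device exceeds the scaled
noise and interference. -/
lemma le_sinr_iff {ω : Ω} (hω : 0 < S.h₀ ω) :
    ENNReal.ofReal net.gammaTh ≤ S.sinr ω ↔
      ENNReal.ofReal (net.gammaTh / net.rho) * S.intra ω +
        ENNReal.ofReal (net.gammaTh / net.rho) * S.inter ω +
        ENNReal.ofReal (net.gammaTh * net.sigma ^ 2 / net.rho) ≤ ENNReal.ofReal (S.h₀ ω) := by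
  have hρ := net.rho_pos
  have hγ := net.gammaTh_pos
  have h1 : ENNReal.ofReal net.gammaTh =
      ENNReal.ofReal net.rho * ENNReal.ofReal (net.gammaTh / net.rho) := by
    rw [← ENNReal.ofReal_mul hρ.le]
    congr 1
    field_simp
  have h2 : ENNReal.ofReal (net.gammaTh * net.sigma ^ 2 / net.rho) =
      ENNReal.ofReal (net.gammaTh / net.rho) * ENNReal.ofReal (net.sigma ^ 2) := by
    rw [← ENNReal.ofReal_mul (by positivity)]
    congr 1
    ring
  -- The numerator is neither `0` nor `∞`, so the denominator may be either.
  rw [sinr, ENNReal.le_div_iff_mul_le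
    (Or.inr (ENNReal.ofReal_pos.2 (mul_pos hρ hω)).ne') (Or.inr ENNReal.ofReal_ne_top), h1, h2,
    ENNReal.ofReal_mul hρ.le, mul_assoc, ENNReal.mul_le_mul_iff_right
      (ENNReal.ofReal_pos.2 hρ).ne' ENNReal.ofReal_ne_top, mul_add, mul_add]

lemma successProb_eq_mul [IsProbabilityMeasure P] : S.successProb =
    (∫⁻ ω, expNeg (ENNReal.ofReal (net.gammaTh / net.rho) * S.intra ω) ∂P).toReal *
    (∫⁻ ω, expNeg (ENNReal.ofReal (net.gammaTh / net.rho) * S.inter ω) ∂P).toReal *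
    Real.exp (-(net.gammaTh * net.sigma ^ 2 / net.rho)) := by
  set k := ENNReal.ofReal (net.gammaTh / net.rho) with hk
  set z := ENNReal.ofReal (net.gammaTh * net.sigma ^ 2 / net.rho) with hz
  have hsup : ∀ s : Set (Fin 4), ⨆ i ∈ s, S.sources i ≤ (inferInstance : MeasurableSpace Ω) :=
    fun s => iSup₂_le fun i _ => S.sources_le i
  have hintra := S.measurable_scaled_intra (s := {1, 2}) (by simp) (by simp)
  have hinter := S.measurable_scaled_inter (s := {3}) (by simp)
  -- Source `0` is kept apart for the tail of `h₀`; afterwards `{1, 2}` against `{3}` separates the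
  -- two interferences.
  have hW : Measurable[⨆ i ∈ ({1, 2, 3} : Set (Fin 4)), S.sources i]
      fun ω => k * S.intra ω + k * S.inter ω + z :=
    ((S.measurable_scaled_intra (by simp) (by simp)).add
      (S.measurable_scaled_inter (by simp))).add_const z
  have hh₀ : Measurable[⨆ i ∈ ({0} : Set (Fin 4)), S.sources i] S.h₀ :=
    (comap_measurable S.h₀).mono
      (le_iSup₂ (f := fun i (_ : i ∈ ({0} : Set (Fin 4))) => S.sources i) 0 rfl) le_rfl
  have hmeas : P {ω | ENNReal.ofReal net.gammaTh ≤ S.sinr ω} =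
      P {ω | k * S.intra ω + k * S.inter ω + z ≤ ENNReal.ofReal (S.h₀ ω)} := by
    refine measure_congr ?_
    filter_upwards [S.ae_pos_h₀] with ω hω
    exact propext (S.le_sinr_iff hω)
  rw [successProb, measureReal_def, hmeas, measure_le_ofReal_of_indepFun (hW.mono (hsup _) le_rfl)
    S.h₀_law (S.indepFun_of_sources (by simp) hW hh₀)]
  simp_rw [expNeg_add]
  have hm1 : Measurable fun ω => expNeg (k * S.intra ω) :=
    measurable_expNeg.comp (hintra.mono (hsup _) le_rfl)
  have hm2 : Measurable fun ω => expNeg (k * S.inter ω) :=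
    measurable_expNeg.comp (hinter.mono (hsup _) le_rfl)
  have hm12 : Measurable fun ω => expNeg (k * S.intra ω) * expNeg (k * S.inter ω) := hm1.mul hm2
  rw [lintegral_mul_const _ hm12,
    lintegral_mul_eq_lintegral_mul_lintegral_of_indepFun'' hm1.aemeasurable hm2.aemeasurable
      (S.indepFun_of_sources (s := {1, 2}) (t := {3}) (by simp)
        (measurable_expNeg.comp hintra) (measurable_expNeg.comp hinter)),
    hz, expNeg_ofReal (div_nonneg (mul_nonneg net.gammaTh_pos.le (sq_nonneg _)) net.rho_pos.le),
    ENNReal.toReal_mul, ENNReal.toReal_mul, ENNReal.toReal_ofReal (Real.exp_pos _).le]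

end Slot

end RachNetwork

end

theorem theorem1 (net : RachNetwork) (m : ℕ) (p₀ : Fin net.xi)
    {Ω : Type*} [MeasurableSpace Ω] (P : Measure Ω) [IsProbabilityMeasure P]
    (S : net.Slot m p₀ Ω P) :
    IntegrableOn (fun y : ℝ => y / (1 + y ^ net.alpha))
      (Ioi (net.gammaTh ^ (-1 / net.alpha))) ∧
    S.successProb =
      Real.exp (-(net.gammaTh * net.sigma ^ 2 / net.rho)
        - 2 * net.gammaTh ^ (2 / net.alpha) * (net.T m * net.R m * net.lamDp / net.lamB) *
          ∫ y in Ioi (net.gammaTh ^ (-1 / net.alpha)), y / (1 + y ^ net.alpha)) *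
      (1 + net.T m * net.R m * net.lamDp * net.gammaTh /
        (voronoiConst * net.lamB * (1 + net.gammaTh))) ^ (-voronoiConst - 1) := by
  have hγ := net.gammaTh_pos
  refine ⟨integrableOn_div_one_add_rpow net.two_lt_alpha (Real.rpow_pos_of_pos hγ _), ?_⟩
  have hc : 0 < voronoiConst := by norm_num [voronoiConst]
  have hB := net.lamB_pos
  have hT := net.T_nonneg m
  have hR := net.R_nonneg m
  have hD := net.lamDp_nonneg
  rw [S.successProb_eq_mul, S.lintegral_expNeg_intra, S.lintegral_expNeg_inter,
    ENNReal.toReal_ofReal (Real.exp_pos _).le, ENNReal.toReal_ofReal (by positivity), mul_assoc,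
    ← Real.exp_add, mul_comm]
  congr 2
  ring
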